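/- Let $n\ge 2$, let $\mathbb{B}^n=\{z\in\mathbb{R}^n : |z|<1\}$, and for $z\in\mathbb{B}^n$ let $d(z)=1-|z|$ be the distance from $z$ to $\partial\mathbb{B}^n$. For $x,y\in\mathbb{B}^n$ let $$\rho(x,y)=\inf_\gamma\int_\gamma\frac{2\,|dz|}{1-|z|^2},\qquad j(x,y)=\log\left(1+\frac{|x-y|}{\min\{d(x),d(y)\}}\right),$$ where the infimum is over all rectifiable curves $\gamma$ in $\mathbb{B}^n$ joining $x$ and $y$, and let $B_\rho(x,r)=\{y\in\mathbb{B}^n:\rho(x,y)<r\}$ and $B_j(x,r)=\{y\in\mathbb{B}^n: j(x,y)<r\}$. For $x\in\mathbb{B}^n$ and $r>0$ put $$m=\max\left\{\log\left(1+(1+|x|)\sinh\frac r2\right),\ \log\left(1+(1-|x|)\frac{e^r-1}{2}\right)\right\},\qquad M=\log\left(1+(1+|x|)\frac{e^r-1}{2}\right).$$ Then for all $x\in\mathbb{B}^n$ and $r>0$ $$B_j(x,m)\subset B_\rho(x,r)\subset B_j(x,M).$$ Both inclusions are sharp: for every $x\in\mathbb{B}^n$ and $r>0$, $B_j(x,s)\not\subset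 B_\rho(x,r)$ for every $s>m$, and $B_\rho(x,r)\not\subset B_j(x,s)$ for every $s<M$. Moreover, for each fixed $x\in\mathbb{B}^n$, $M/m\to1$ as $r\to0^+$. -/

import Mathlib

open Set Filter Topology

noncomputable section

namespace BallInclusion

/-- The line integral `∫_γ w |dz|` of a density `w` along a rectifiable curve `γ : [a, b] → E`:
the integral of `w` over `[0, ℓ(γ)]` along the parametrization of `γ` by arc length, where
`ℓ(γ)` is the length (total variation) of `γ`. -/
def lineIntegral {E : Type*} [PseudoEMetricSpace E] (w : E → ℝ) (γ : ℝ → E) (a b : ℝ) : ℝ :=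
  ∫ s in (0 : ℝ)..(eVariationOn γ (Icc a b)).toReal,
    w (naturalParameterization γ (Icc a b) a s)

/-- `γ` restricted to `[a, b]` is a rectifiable curve (continuous and of finite length)
contained in `G` that joins `x` to `y`. -/
structure IsRectifiableCurve {E : Type*} [PseudoEMetricSpace E] (G : Set E) (x y : E)
    (γ : ℝ → E) (a b : ℝ) : Prop where
  le : a ≤ b
  continuousOn : ContinuousOn γ (Icc a b)
  rectifiable : eVariationOn γ (Icc a b) ≠ ⊤
  mapsTo : MapsTo γ (Icc a b) G
  source : γ a = x
  target : γ b = y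

/-- The hyperbolic length `∫_γ 2 |dz| / (1 - |z|²)` of a rectifiable curve in the unit ball. -/
def hyperbolicLength {n : ℕ} (γ : ℝ → EuclideanSpace ℝ (Fin n)) (a b : ℝ) : ℝ :=
  lineIntegral (fun z => 2 / (1 - ‖z‖ ^ 2)) γ a b

/-- The hyperbolic metric of the unit ball: the infimum of the hyperbolic lengths of the
rectifiable curves in the unit ball that join `x` and `y`. -/
def hyperbolicMetric {n : ℕ} (x y : EuclideanSpace ℝ (Fin n)) : ℝ :=
  sInf {l : ℝ | ∃ (γ : ℝ → EuclideanSpace ℝ (Fin n)) (a b : ℝ),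
    IsRectifiableCurve (Metric.ball 0 1) x y γ a b ∧ l = hyperbolicLength γ a b}

/-- The distance ratio metric of a proper subdomain `G` of Euclidean space;
`d(z)` is the distance from `z` to the boundary of `G`. -/
def jMetric {n : ℕ} (G : Set (EuclideanSpace ℝ (Fin n))) (x y : EuclideanSpace ℝ (Fin n)) : ℝ :=
  Real.log (1 + dist x y /
    min (Metric.infDist x (frontier G)) (Metric.infDist y (frontier G)))

/-- The open ball `B_ρ(x, r)` of the hyperbolic metric of the unit ball. -/
def hyperbolicBall {n : ℕ} (x : EuclideanSpace ℝ (Fin n)) (r : ℝ) :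
    Set (EuclideanSpace ℝ (Fin n)) :=
  {y ∈ Metric.ball 0 1 | hyperbolicMetric x y < r}

/-- The open ball `B_j(x, r)` of the distance ratio metric of `G`. -/
def jBall {n : ℕ} (G : Set (EuclideanSpace ℝ (Fin n))) (x : EuclideanSpace ℝ (Fin n)) (r : ℝ) :
    Set (EuclideanSpace ℝ (Fin n)) :=
  {y ∈ G | jMetric G x y < r}

/-- The inner radius `m`, as a function of `t = |x|` and `r`. -/
def innerRadius (t r : ℝ) : ℝ :=
  max (Real.log (1 + (1 + t) * Real.sinh (r / 2)))
    (Real.log (1 + (1 - t) * ((Real.exp r - 1) / 2)))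

/-- The outer radius `M`, as a function of `t = |x|` and `r`. -/
def outerRadius (t r : ℝ) : ℝ :=
  Real.log (1 + (1 + t) * ((Real.exp r - 1) / 2))

end BallInclusion

end

noncomputable section

namespace BallInclusion

/-! Write t = |x|, u = |y|, D = |x - y|, κ = exp (r/2), S = sinh (r/2); then κ² - 1 = 2κS and (e^r -
1)/2 = κS. The hyperbolic metric has the closed form sinh² (ρ/2) = D² / ((1 - t²)(1 - u²))
(`hyperbolicMetric_eq_poincareDist`). The lower bound for lengths compares derivatives along arc
length. The upper bound uses geodesics, obtained by moving x to the origin with an inversion.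

So ρ < r means D² < S²(1 - t²)(1 - u²), while j < log (1 + R) means D < R(1 - t) and D < R(1 - u).
The inclusions become inequalities in t, u, D with |t - u| ≤ D ≤ t + u: `sq_lt_of_lt_mul_sinh` and
`sq_lt_of_lt_mul_exp` for the two terms of m, `lt_mul_exp_of_sq_lt` for M.

Sharpness comes from points at hyperbolic distance exactly r. For M, take the point beyond x on its
ray. For m, take a point with |y| = |x| if (1 - t)κ ≤ 1 + t, and otherwise the point of the diameter
on the other side of the origin; the same threshold decides which term of m is larger. The limit
holds because M and the first term of m both vanish at r = 0 with the same derivative (1 + t)/2. -/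

theorem continuousOn_variationOnFromTo {E : Type*} [PseudoMetricSpace E] {f : ℝ → E}
    {s : Set ℝ} (hf : LocallyBoundedVariationOn f s) (hc : ContinuousOn f s) {a : ℝ}
    (ha : a ∈ s) : ContinuousOn (variationOnFromTo f s a) s := by
  intro b hb
  -- The variation jumps on each side exactly as much as `f` does, hence not at all.
  have hl := variationOnFromTo.tendsto_left ha hb hf ((hc b hb).mono inter_subset_left)
  have hr := variationOnFromTo.tendsto_right ha hb hf ((hc b hb).mono inter_subset_left)
  rw [dist_self, sub_zero] at hl
  rw [dist_self, add_zero] at hr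
  have hs : s = s ∩ Iio b ∪ s ∩ Ioi b ∪ {b} := by
    ext z
    simp only [mem_union, mem_inter_iff, mem_Iio, mem_Ioi, mem_singleton_iff]
    constructor
    · intro h
      rcases lt_trichotomy z b with h' | h' | h' <;> simp [h, h']
    · rintro ((h | h) | rfl)
      exacts [h.1, h.1, hb]
  have : Tendsto (variationOnFromTo f s a) (𝓝[s] b) (𝓝 (variationOnFromTo f s a b)) := by
    nth_rewrite 2 [hs]
    rw [nhdsWithin_union, nhdsWithin_union, nhdsWithin_singleton]
    exact (hl.sup hr).sup (tendsto_pure_nhds _ _)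
  exact this

/-! ### Parametrization by arc length -/

namespace IsRectifiableCurve

variable {E : Type*} [MetricSpace E] {G : Set E} {x y : E} {γ : ℝ → E} {a b : ℝ}

theorem locallyBoundedVariationOn (h : IsRectifiableCurve G x y γ a b) :
    LocallyBoundedVariationOn γ (Icc a b) :=
  BoundedVariationOn.locallyBoundedVariationOn h.rectifiable

theorem variationOnFromTo_right (h : IsRectifiableCurve G x y γ a b) :
    variationOnFromTo γ (Icc a b) a b = (eVariationOn γ (Icc a b)).toReal := by
  rw [variationOnFromTo.eq_of_le _ _ h.le, inter_self]

/-- Continuity excludes gaps in the arc length parameter, so the natural parametrization takes only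
values of the curve on the whole interval of integration. -/
theorem image_variationOnFromTo (h : IsRectifiableCurve G x y γ a b) :
    variationOnFromTo γ (Icc a b) a '' Icc a b = Icc 0 (eVariationOn γ (Icc a b)).toReal := by
  have ha := left_mem_Icc.2 h.le
  have hb := right_mem_Icc.2 h.le
  have hm := variationOnFromTo.monotoneOn h.locallyBoundedVariationOn ha
  have hc := continuousOn_variationOnFromTo h.locallyBoundedVariationOn h.continuousOn ha
  rw [← h.variationOnFromTo_right, ← variationOnFromTo.self γ (Icc a b) a]
  refine Subset.antisymm ?_ (intermediate_value_Icc h.le hc)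
  rintro _ ⟨c, hcs, rfl⟩
  exact ⟨hm ha hcs hcs.1, hm hcs hb hcs.2⟩

theorem naturalParameterization_variationOnFromTo (h : IsRectifiableCurve G x y γ a b) {t : ℝ}
    (ht : t ∈ Icc a b) :
    naturalParameterization γ (Icc a b) a (variationOnFromTo γ (Icc a b) a t) = γ t :=
  edist_eq_zero.1
    (edist_naturalParameterization_eq_zero h.locallyBoundedVariationOn (left_mem_Icc.2 h.le) ht)

theorem naturalParameterization_zero (h : IsRectifiableCurve G x y γ a b) :
    naturalParameterization γ (Icc a b) a 0 = x := by
  rw [← variationOnFromTo.self γ (Icc a b) a,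
    h.naturalParameterization_variationOnFromTo (left_mem_Icc.2 h.le), h.source]

theorem naturalParameterization_length (h : IsRectifiableCurve G x y γ a b) :
    naturalParameterization γ (Icc a b) a (eVariationOn γ (Icc a b)).toReal = y := by
  rw [← h.variationOnFromTo_right,
    h.naturalParameterization_variationOnFromTo (right_mem_Icc.2 h.le), h.target]

theorem mapsTo_naturalParameterization (h : IsRectifiableCurve G x y γ a b) :
    MapsTo (naturalParameterization γ (Icc a b) a)
      (Icc 0 (eVariationOn γ (Icc a b)).toReal) G := by
  rw [← h.image_variationOnFromTo]
  rintro _ ⟨t, ht, rfl⟩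
  rw [h.naturalParameterization_variationOnFromTo ht]
  exact h.mapsTo ht

theorem lipschitzOnWith_naturalParameterization (h : IsRectifiableCurve G x y γ a b) :
    LipschitzOnWith 1 (naturalParameterization γ (Icc a b) a)
      (Icc 0 (eVariationOn γ (Icc a b)).toReal) := by
  have hu := has_unit_speed_naturalParameterization γ h.locallyBoundedVariationOn
    (left_mem_Icc.2 h.le)
  rw [h.image_variationOnFromTo] at hu
  have key : ∀ s ∈ Icc 0 (eVariationOn γ (Icc a b)).toReal,
      ∀ t ∈ Icc 0 (eVariationOn γ (Icc a b)).toReal, s ≤ t →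
      dist (naturalParameterization γ (Icc a b) a s) (naturalParameterization γ (Icc a b) a t)
        ≤ dist s t := by
    intro s hs t ht hst
    have h1 := eVariationOn.edist_le (naturalParameterization γ (Icc a b) a)
      (s := Icc 0 (eVariationOn γ (Icc a b)).toReal ∩ Icc s t)
      ⟨hs, left_mem_Icc.2 hst⟩ ⟨ht, right_mem_Icc.2 hst⟩
    rw [hu hs ht, edist_dist, NNReal.coe_one, one_mul,
      ENNReal.ofReal_le_ofReal_iff (sub_nonneg.2 hst)] at h1
    rwa [dist_comm s, Real.dist_eq, abs_of_nonneg (sub_nonneg.2 hst)]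
  refine LipschitzOnWith.of_dist_le_mul fun s hs t ht => ?_
  rw [NNReal.coe_one, one_mul]
  rcases le_total s t with hst | hst
  · exact key s hs t ht hst
  · rw [dist_comm, dist_comm s]
    exact key t ht s hs hst

end IsRectifiableCurve

/-! ### The closed form of the hyperbolic metric -/

section PoincareDist

variable {E : Type*} [NormedAddCommGroup E]

theorem one_sub_norm_sq_pos {z : E} (hz : z ∈ Metric.ball (0 : E) 1) : 0 < 1 - ‖z‖ ^ 2 := by
  rw [mem_ball_zero_iff] at hz
  nlinarith [norm_nonneg z]

/-- The closed form of the hyperbolic metric of the unit ball. -/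
def poincareDist (x y : E) : ℝ :=
  2 * Real.arsinh (dist x y / √((1 - ‖x‖ ^ 2) * (1 - ‖y‖ ^ 2)))

theorem poincareDist_nonneg (x y : E) : 0 ≤ poincareDist x y :=
  mul_nonneg zero_le_two (Real.arsinh_nonneg_iff.2 (by positivity))

theorem poincareDist_self (x : E) : poincareDist x x = 0 := by simp [poincareDist]

theorem poincareDist_comm (x y : E) : poincareDist x y = poincareDist y x := by
  simp only [poincareDist, dist_comm x, mul_comm (1 - ‖x‖ ^ 2)]

theorem poincareDist_lt_iff {x y : E} {r : ℝ} (hx : x ∈ Metric.ball (0 : E) 1)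
    (hy : y ∈ Metric.ball (0 : E) 1) (hr : 0 ≤ r) :
    poincareDist x y < r ↔
      dist x y ^ 2 < Real.sinh (r / 2) ^ 2 * ((1 - ‖x‖ ^ 2) * (1 - ‖y‖ ^ 2)) := by
  have h : 0 < (1 - ‖x‖ ^ 2) * (1 - ‖y‖ ^ 2) :=
    mul_pos (one_sub_norm_sq_pos hx) (one_sub_norm_sq_pos hy)
  have hs : 0 ≤ Real.sinh (r / 2) := Real.sinh_nonneg_iff.2 (by linarith)
  rw [poincareDist, ← lt_div_iff₀' two_pos, ← Real.sinh_lt_sinh, Real.sinh_arsinh,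
    div_lt_iff₀ (Real.sqrt_pos.2 h),
    ← pow_lt_pow_iff_left₀ dist_nonneg (by positivity) two_ne_zero, mul_pow, Real.sq_sqrt h.le]

theorem poincareDist_eq_of_sq {x y : E} {r : ℝ} (hx : x ∈ Metric.ball (0 : E) 1)
    (hy : y ∈ Metric.ball (0 : E) 1) (hr : 0 ≤ r)
    (h : dist x y ^ 2 = Real.sinh (r / 2) ^ 2 * ((1 - ‖x‖ ^ 2) * (1 - ‖y‖ ^ 2))) :
    poincareDist x y = r := by
  have h' : 0 < (1 - ‖x‖ ^ 2) * (1 - ‖y‖ ^ 2) :=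
    mul_pos (one_sub_norm_sq_pos hx) (one_sub_norm_sq_pos hy)
  have hs : 0 ≤ Real.sinh (r / 2) := Real.sinh_nonneg_iff.2 (by linarith)
  have : dist x y = Real.sinh (r / 2) * √((1 - ‖x‖ ^ 2) * (1 - ‖y‖ ^ 2)) := by
    rw [← pow_left_inj₀ dist_nonneg (by positivity) two_ne_zero, h, mul_pow, Real.sq_sqrt h'.le]
  rw [poincareDist, this, mul_div_cancel_right₀ _ (Real.sqrt_pos.2 h').ne', Real.arsinh_sinh]
  ring

theorem sinh_half_poincareDist_sq {x y : E} (hx : x ∈ Metric.ball (0 : E) 1)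
    (hy : y ∈ Metric.ball (0 : E) 1) :
    dist x y ^ 2 =
      Real.sinh (poincareDist x y / 2) ^ 2 * ((1 - ‖x‖ ^ 2) * (1 - ‖y‖ ^ 2)) := by
  have h' : 0 < (1 - ‖x‖ ^ 2) * (1 - ‖y‖ ^ 2) :=
    mul_pos (one_sub_norm_sq_pos hx) (one_sub_norm_sq_pos hy)
  rw [poincareDist, mul_div_cancel_left₀ _ two_ne_zero, Real.sinh_arsinh, div_pow,
    Real.sq_sqrt h'.le, div_mul_cancel₀ _ h'.ne']

/-- This is arsinh v ≤ v. The factor tends to the density 2 / (1 - |x|²) as y tends to x, which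
makes the bound infinitesimally sharp. -/
theorem poincareDist_le (x y : E) :
    poincareDist x y ≤ 2 / √((1 - ‖x‖ ^ 2) * (1 - ‖y‖ ^ 2)) * dist x y := by
  have h : 0 ≤ dist x y / √((1 - ‖x‖ ^ 2) * (1 - ‖y‖ ^ 2)) := by positivity
  have := Real.self_le_sinh_iff.2 (Real.arsinh_nonneg_iff.2 h)
  rw [Real.sinh_arsinh] at this
  calc poincareDist x y ≤ 2 * (dist x y / √((1 - ‖x‖ ^ 2) * (1 - ‖y‖ ^ 2))) :=
        mul_le_mul_of_nonneg_left this zero_le_two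
    _ = _ := by ring

theorem continuousOn_poincareDist (x : E) (hx : x ∈ Metric.ball (0 : E) 1) :
    ContinuousOn (poincareDist x) (Metric.ball (0 : E) 1) := by
  unfold poincareDist
  refine continuousOn_const.mul (Real.continuous_arsinh.comp_continuousOn ?_)
  refine ContinuousOn.div (by fun_prop) (by fun_prop) fun y hy => ?_
  exact (Real.sqrt_pos.2 (mul_pos (one_sub_norm_sq_pos hx) (one_sub_norm_sq_pos hy))).ne'

/-- In the coordinate tanh (a/2), a diameter is parametrized by hyperbolic length. -/
theorem sinh_half_sub_sq (a b : ℝ) :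
    (Real.tanh (a / 2) - Real.tanh (b / 2)) ^ 2 = Real.sinh ((a - b) / 2) ^ 2 *
      ((1 - Real.tanh (a / 2) ^ 2) * (1 - Real.tanh (b / 2) ^ 2)) := by
  have ha := Real.cosh_pos (a / 2)
  have hb := Real.cosh_pos (b / 2)
  have hca := Real.cosh_sq (a / 2)
  have hcb := Real.cosh_sq (b / 2)
  have h1 : 1 - Real.tanh (a / 2) ^ 2 = 1 / Real.cosh (a / 2) ^ 2 := by
    rw [Real.tanh_eq_sinh_div_cosh]; field_simp; linarith
  have h2 : 1 - Real.tanh (b / 2) ^ 2 = 1 / Real.cosh (b / 2) ^ 2 := by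
    rw [Real.tanh_eq_sinh_div_cosh]; field_simp; linarith
  rw [h1, h2, sub_div, Real.sinh_sub, Real.tanh_eq_sinh_div_cosh, Real.tanh_eq_sinh_div_cosh]
  field_simp

theorem norm_eq_tanh {p : E} (hp : p ∈ Metric.ball (0 : E) 1) :
    ‖p‖ = Real.tanh (poincareDist 0 p / 2) := by
  have h := sinh_half_poincareDist_sq (Metric.mem_ball_self one_pos) hp
  have hp' := one_sub_norm_sq_pos hp
  have h0 := poincareDist_nonneg 0 p
  have hc := Real.cosh_sq (poincareDist 0 p / 2)
  have hcp := Real.cosh_pos (poincareDist 0 p / 2)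
  have hs : 0 ≤ Real.sinh (poincareDist 0 p / 2) := Real.sinh_nonneg_iff.2 (by linarith)
  rw [dist_zero_left, norm_zero] at h
  rw [Real.tanh_eq_sinh_div_cosh, eq_div_iff hcp.ne',
    ← pow_left_inj₀ (by positivity) hs two_ne_zero, mul_pow, hc]
  linarith

/-- Rotating p onto the ray of q can only decrease |p - q|, to ||q| - |p||, and on a ray the
hyperbolic distance is additive. -/
theorem poincareDist_zero_triangle {p q : E} (hp : p ∈ Metric.ball (0 : E) 1)
    (hq : q ∈ Metric.ball (0 : E) 1) :
    poincareDist 0 q ≤ poincareDist 0 p + poincareDist p q := by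
  by_contra! hlt
  have h0 := poincareDist_nonneg p q
  have h := sinh_half_sub_sq (poincareDist 0 q) (poincareDist 0 p)
  rw [← norm_eq_tanh hp, ← norm_eq_tanh hq] at h
  have h1 : poincareDist p q < poincareDist 0 q - poincareDist 0 p := by linarith
  rw [poincareDist_lt_iff hp hq (by linarith), mul_comm (1 - ‖p‖ ^ 2), ← h] at h1
  have h2 := abs_norm_sub_norm_le q p
  rw [← dist_eq_norm, dist_comm] at h2
  have := sq_le_sq' (by linarith [abs_nonneg (‖q‖ - ‖p‖), dist_nonneg (x := p) (y := q)]) h2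
  rw [sq_abs] at this
  linarith

end PoincareDist

/-! ### Isometric inversions and geodesics -/

section Involution

variable {E : Type*} [NormedAddCommGroup E] [InnerProductSpace ℝ E]

theorem exists_unit_eq_norm_smul [Nontrivial E] (p : E) : ∃ e : E, ‖e‖ = 1 ∧ p = ‖p‖ • e := by
  rcases eq_or_ne p 0 with rfl | h
  · obtain ⟨e, he⟩ := exists_norm_eq E zero_le_one
    exact ⟨e, he, by simp⟩
  · exact ⟨‖p‖⁻¹ • p, norm_smul_inv_norm (𝕜 := ℝ) h, by
      rw [smul_smul, mul_inv_cancel₀ (norm_ne_zero_iff.2 h), one_smul]⟩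

/-- The hypothesis on c says that the sphere of inversion is orthogonal to the unit sphere. Then 1 -
|z|² scales by the conformal factor of the inversion, which cancels in the closed form. -/
theorem one_sub_norm_inversion_sq {c z : E} {R : ℝ} (hc : ‖c‖ ^ 2 = R ^ 2 + 1) (hz : z ≠ c) :
    1 - ‖EuclideanGeometry.inversion c R z‖ ^ 2 = R ^ 2 / dist z c ^ 2 * (1 - ‖z‖ ^ 2) := by
  have hd : 0 < dist z c := dist_pos.2 hz
  have e : ‖z‖ ^ 2 = dist z c ^ 2 + 2 * inner ℝ (z - c) c + ‖c‖ ^ 2 := by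
    rw [dist_eq_norm, ← norm_add_sq_real, sub_add_cancel]
  rw [EuclideanGeometry.inversion, vsub_eq_sub, vadd_eq_add, norm_add_sq_real, norm_smul,
    real_inner_smul_left, mul_pow, ← dist_eq_norm, Real.norm_eq_abs, sq_abs, e, hc]
  field_simp
  ring

/-- An isometric involution of the Poincaré ball that moves a given point to the origin. -/
theorem exists_involution {a : E} (ha : a ∈ Metric.ball (0 : E) 1) :
    ∃ T : E → E, T a = 0 ∧ T 0 = a ∧
      MapsTo T (Metric.ball 0 1) (Metric.ball 0 1) ∧
      (∀ z, T (T z) = z) ∧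
      ∀ z ∈ Metric.ball (0 : E) 1, ∀ w ∈ Metric.ball (0 : E) 1,
        poincareDist (T z) (T w) = poincareDist z w := by
  rcases eq_or_ne a 0 with rfl | h0
  · exact ⟨id, rfl, rfl, mapsTo_id _, fun _ => rfl, fun _ _ _ _ => rfl⟩
  have ha1 : ‖a‖ < 1 := mem_ball_zero_iff.1 ha
  have hap : 0 < ‖a‖ := norm_pos_iff.2 h0
  set c : E := (‖a‖ ^ 2)⁻¹ • a with hcdef
  set R : ℝ := √((‖a‖ ^ 2)⁻¹ - 1) with hRdef
  have hRpos : 0 < (‖a‖ ^ 2)⁻¹ - 1 := by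
    rw [sub_pos]
    exact (one_lt_inv₀ (by positivity)).2 (by nlinarith)
  have hR2 : R ^ 2 = (‖a‖ ^ 2)⁻¹ - 1 := Real.sq_sqrt hRpos.le
  have hR0 : R ≠ 0 := (Real.sqrt_pos.2 hRpos).ne'
  have hc : ‖c‖ ^ 2 = R ^ 2 + 1 := by
    rw [hR2, hcdef, norm_smul, mul_pow, norm_inv, norm_pow, norm_norm]
    field_simp
    ring
  have hne : ∀ z ∈ Metric.ball (0 : E) 1, z ≠ c := by
    rintro z hz rfl
    rw [mem_ball_zero_iff] at hz
    nlinarith [norm_nonneg c, sq_nonneg R]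
  have hpos : ∀ z ∈ Metric.ball (0 : E) 1, 0 < R ^ 2 / dist z c ^ 2 := fun z hz =>
    div_pos (by positivity) (pow_pos (dist_pos.2 (hne z hz)) 2)
  have hmaps : MapsTo (EuclideanGeometry.inversion c R) (Metric.ball 0 1) (Metric.ball 0 1) := by
    intro z hz
    have h1 := one_sub_norm_inversion_sq hc (hne z hz)
    have h2 := mul_pos (hpos z hz) (one_sub_norm_sq_pos hz)
    rw [mem_ball_zero_iff]
    nlinarith [norm_nonneg (EuclideanGeometry.inversion c R z)]
  have h0a : EuclideanGeometry.inversion c R 0 = a := by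
    rw [EuclideanGeometry.inversion, vsub_eq_sub, vadd_eq_add, zero_sub, dist_zero_left, div_pow,
      hc, hR2, smul_neg, hcdef, smul_smul, ← sub_eq_neg_add, ← sub_smul]
    convert one_smul ℝ a using 2
    field_simp
    ring
  refine ⟨EuclideanGeometry.inversion c R, ?_, h0a, hmaps,
    EuclideanGeometry.inversion_inversion c hR0, fun z hz w hw => ?_⟩
  · rw [← h0a, EuclideanGeometry.inversion_inversion c hR0]
  have hz' := dist_pos.2 (hne z hz)
  have hw' := dist_pos.2 (hne w hw)
  refine poincareDist_eq_of_sq (hmaps hz) (hmaps hw) (poincareDist_nonneg _ _) ?_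
  rw [EuclideanGeometry.dist_inversion_inversion (hne z hz) (hne w hw), mul_pow,
    sinh_half_poincareDist_sq hz hw, one_sub_norm_inversion_sq hc (hne z hz),
    one_sub_norm_inversion_sq hc (hne w hw)]
  field_simp

theorem poincareDist_triangle {x y z : E} (hx : x ∈ Metric.ball (0 : E) 1)
    (hy : y ∈ Metric.ball (0 : E) 1) (hz : z ∈ Metric.ball (0 : E) 1) :
    poincareDist x z ≤ poincareDist x y + poincareDist y z := by
  obtain ⟨T, hT, -, hm, -, hi⟩ := exists_involution hx
  rw [← hi x hx z hz, ← hi x hx y hy, ← hi y hy z hz, hT]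
  exact poincareDist_zero_triangle (hm hy) (hm hz)

/-- Every two points of the Poincaré ball are joined by a geodesic. -/
theorem exists_geodesic [Nontrivial E] {x y : E} (hx : x ∈ Metric.ball (0 : E) 1)
    (hy : y ∈ Metric.ball (0 : E) 1) :
    ∃ γ : ℝ → E, γ 0 = x ∧ γ (poincareDist x y) = y ∧ (∀ t, γ t ∈ Metric.ball (0 : E) 1) ∧
      ∀ s t, s ≤ t → poincareDist (γ s) (γ t) = t - s := by
  obtain ⟨T, hTx, hT0, hm, hTT, hi⟩ := exists_involution hx
  obtain ⟨e, he, hpe⟩ := exists_unit_eq_norm_smul (T y)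
  have hn : ∀ t : ℝ, ‖Real.tanh (t / 2) • e‖ = |Real.tanh (t / 2)| := fun t => by
    rw [norm_smul, he, mul_one, Real.norm_eq_abs]
  have hb : ∀ t : ℝ, Real.tanh (t / 2) • e ∈ Metric.ball (0 : E) 1 := fun t => by
    rw [mem_ball_zero_iff, hn]
    exact Real.abs_tanh_lt_one _
  -- The image under the isometry of the diameter through `T y`, at unit hyperbolic speed.
  refine ⟨fun t => T (Real.tanh (t / 2) • e), by simp [hT0], ?_, fun t => hm (hb t), ?_⟩
  · have h1 : poincareDist x y = poincareDist 0 (T y) := by rw [← hi x hx y hy, hTx]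
    simp only [h1]
    rw [← norm_eq_tanh (hm hy), ← hpe, hTT]
  · intro s t hst
    rw [hi _ (hb s) _ (hb t), poincareDist_comm]
    refine poincareDist_eq_of_sq (hb t) (hb s) (sub_nonneg.2 hst) ?_
    rw [hn, hn, sq_abs, sq_abs, ← sinh_half_sub_sq, dist_eq_norm, ← sub_smul, norm_smul, he,
      mul_one, Real.norm_eq_abs, sq_abs]

end Involution

/-! ### Lower bound for hyperbolic lengths -/

theorem clamp_mem_Icc {l : ℝ} (hl : 0 ≤ l) (s : ℝ) : max 0 (min s l) ∈ Icc 0 l :=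
  ⟨le_max_left _ _, max_le hl (min_le_right _ _)⟩

theorem clamp_eq_self {l s : ℝ} (hs : s ∈ Icc 0 l) : max 0 (min s l) = s := by
  rw [min_eq_left hs.2, max_eq_right hs.1]

section

variable {n : ℕ} {x y : EuclideanSpace ℝ (Fin n)} {γ : ℝ → EuclideanSpace ℝ (Fin n)} {a b : ℝ}

/-- The hyperbolic length of a curve is the integral of a density that is continuous on `ℝ`. -/
theorem IsRectifiableCurve.exists_density
    (h : IsRectifiableCurve (Metric.ball 0 1) x y γ a b) :
    ∃ g : ℝ → ℝ, Continuous g ∧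
      (∀ s ∈ Icc 0 (eVariationOn γ (Icc a b)).toReal,
        g s = 2 / (1 - ‖naturalParameterization γ (Icc a b) a s‖ ^ 2)) ∧
      hyperbolicLength γ a b = ∫ s in (0 : ℝ)..(eVariationOn γ (Icc a b)).toReal, g s := by
  set l := (eVariationOn γ (Icc a b)).toReal
  have hl : 0 ≤ l := ENNReal.toReal_nonneg
  set c := naturalParameterization γ (Icc a b) a with hc
  have hcc : Continuous fun s => c (max 0 (min s l)) :=
    h.lipschitzOnWith_naturalParameterization.continuousOn.comp_continuous (by fun_prop)
      (clamp_mem_Icc hl)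
  -- Clamping the parameter makes the density continuous on all of ℝ, so its primitive is
  -- differentiable at the end points too.
  refine ⟨fun s => 2 / (1 - ‖c (max 0 (min s l))‖ ^ 2), ?_, fun s hs => ?_, ?_⟩
  · refine continuous_const.div (continuous_const.sub (hcc.norm.pow 2)) fun s => ?_
    exact (one_sub_norm_sq_pos (h.mapsTo_naturalParameterization (clamp_mem_Icc hl s))).ne'
  · simp only [clamp_eq_self hs]
  · refine intervalIntegral.integral_congr fun s hs => ?_
    rw [uIcc_of_le hl] at hs
    simp only [clamp_eq_self hs, hc]

/-- Along arc length c, the triangle inequality and the 1-Lipschitz bound keep the right slopes of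
ρ(x, c(s)) asymptotically below the density. Comparison of slopes needs no differentiability of c.
-/
theorem poincareDist_le_hyperbolicLength
    (h : IsRectifiableCurve (Metric.ball 0 1) x y γ a b) :
    poincareDist x y ≤ hyperbolicLength γ a b := by
  obtain ⟨g, hg, hgc, hlen⟩ := h.exists_density
  set l := (eVariationOn γ (Icc a b)).toReal
  have hl : 0 ≤ l := ENNReal.toReal_nonneg
  have hx : x ∈ Metric.ball 0 1 := h.source ▸ h.mapsTo (left_mem_Icc.2 h.le)
  have hmaps := h.mapsTo_naturalParameterization
  have hlip := h.lipschitzOnWith_naturalParameterization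
  have h0 := h.naturalParameterization_zero
  have h1 := h.naturalParameterization_length
  set c := naturalParameterization γ (Icc a b) a
  rw [hlen, ← h1]
  have hd : ∀ s, HasDerivAt (fun u => ∫ t in (0 : ℝ)..u, g t) (g s) s := fun s =>
    (hg.integral_hasStrictDerivAt 0 s).hasDerivAt
  refine image_le_of_liminf_slope_right_le_deriv_boundary (f := fun s => poincareDist x (c s))
    (B := fun u => ∫ t in (0 : ℝ)..u, g t) (B' := g) (a := 0) (b := l)
    ((continuousOn_poincareDist x hx).comp hlip.continuousOn hmaps) ?_
    (fun s _ => (hd s).continuousAt.continuousWithinAt) (fun s _ => (hd s).hasDerivWithinAt) ?_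
    (right_mem_Icc.2 hl)
  · simp [h0, poincareDist_self]
  intro s hs q hq
  have hsl : s ∈ Icc 0 l := ⟨hs.1, hs.2.le⟩
  have hps := one_sub_norm_sq_pos (hmaps hsl)
  have hK : ContinuousWithinAt (fun z => 2 / √((1 - ‖c s‖ ^ 2) * (1 - ‖c z‖ ^ 2))) (Icc 0 l) s := by
    have := hlip.continuousOn s hsl
    refine ContinuousWithinAt.div continuousWithinAt_const (by fun_prop) ?_
    exact (Real.sqrt_pos.2 (mul_pos hps hps)).ne'
  have hKs : 2 / √((1 - ‖c s‖ ^ 2) * (1 - ‖c s‖ ^ 2)) < q := by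
    rwa [Real.sqrt_mul_self hps.le, ← hgc s hsl]
  have hev : ∀ᶠ z in 𝓝[>] s, z ∈ Icc 0 l := by
    filter_upwards [Ioo_mem_nhdsGT hs.2] with z hz
    exact ⟨hs.1.trans hz.1.le, hz.2.le⟩
  have hle : 𝓝[>] s ≤ 𝓝[Icc 0 l] s :=
    le_inf inf_le_left (le_principal_iff.2 hev)
  refine Eventually.frequently ?_
  filter_upwards [hle (hK.eventually_lt continuousWithinAt_const hKs), hev, self_mem_nhdsWithin]
    with z hz hzl hsz
  have hsz' : 0 < z - s := sub_pos.2 hsz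
  rw [slope_def_field, div_lt_iff₀ hsz']
  have ht := poincareDist_triangle hx (hmaps hsl) (hmaps hzl)
  have hb := poincareDist_le (c s) (c z)
  have hd := hlip.dist_le_mul s hsl z hzl
  rw [NNReal.coe_one, one_mul, dist_comm s, Real.dist_eq, abs_of_pos hsz'] at hd
  have hKz : 0 ≤ 2 / √((1 - ‖c s‖ ^ 2) * (1 - ‖c z‖ ^ 2)) := by positivity
  have := mul_le_mul_of_nonneg_left hd hKz
  have := mul_lt_mul_of_pos_right hz hsz'
  linarith

end

/-! ### Hyperbolic length of a geodesic -/

theorem sinh_le_mul_cosh {u : ℝ} (hu : 0 ≤ u) : Real.sinh u ≤ u * Real.cosh u := by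
  have := (convex_Icc 0 u).image_sub_le_mul_sub_of_deriv_le Real.continuous_sinh.continuousOn
    Real.differentiable_sinh.differentiableOn (C := Real.cosh u) (fun v hv => ?_)
    0 (left_mem_Icc.2 hu) u (right_mem_Icc.2 hu) hu
  · rwa [Real.sinh_zero, sub_zero, sub_zero, mul_comm] at this
  rw [interior_Icc] at hv
  rw [Real.deriv_sinh, Real.cosh_le_cosh, abs_of_pos hv.1, abs_of_nonneg hu]
  exact hv.2.le

section Geodesic

variable {E : Type*} [NormedAddCommGroup E] {γ : ℝ → E}

/-- On short intervals the constant is close to (1 - |γ|²)/2, the reciprocal of the density. -/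
theorem lipschitzOnWith_geodesic (hb : ∀ t, γ t ∈ Metric.ball (0 : E) 1)
    (hγ : ∀ s t, s ≤ t → poincareDist (γ s) (γ t) = t - s) {a b : ℝ} {K : NNReal}
    (hK : ∀ t ∈ Icc a b, 1 - ‖γ t‖ ^ 2 ≤ K) :
    LipschitzOnWith (Real.toNNReal (Real.cosh ((b - a) / 2) / 2) * K) γ (Icc a b) := by
  have key : ∀ s ∈ Icc a b, ∀ t ∈ Icc a b, s ≤ t →
      dist (γ s) (γ t) ≤ Real.cosh ((b - a) / 2) / 2 * K * dist s t := by
    intro s hs t ht hst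
    rw [dist_comm s, Real.dist_eq, abs_of_nonneg (sub_nonneg.2 hst)]
    have h := sinh_half_poincareDist_sq (hb s) (hb t)
    rw [hγ s t hst] at h
    have h0 : 0 ≤ (t - s) / 2 := by linarith
    have h1 := sinh_le_mul_cosh h0
    have h2 : Real.cosh ((t - s) / 2) ≤ Real.cosh ((b - a) / 2) := by
      rw [Real.cosh_le_cosh, abs_of_nonneg h0, abs_of_nonneg (by linarith [hs.1, ht.2])]
      linarith [hs.1, ht.2]
    have h3 : Real.sinh ((t - s) / 2) ≤ Real.cosh ((b - a) / 2) / 2 * (t - s) := by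
      nlinarith
    have h4 : 0 ≤ Real.sinh ((t - s) / 2) := Real.sinh_nonneg_iff.2 h0
    have h5 : (1 - ‖γ s‖ ^ 2) * (1 - ‖γ t‖ ^ 2) ≤ K * K :=
      mul_le_mul (hK s hs) (hK t ht) (one_sub_norm_sq_pos (hb t)).le K.2
    have h6 : dist (γ s) (γ t) ^ 2 ≤ (Real.sinh ((t - s) / 2) * K) ^ 2 := by
      rw [h, mul_pow, pow_two (K : ℝ)]
      exact mul_le_mul_of_nonneg_left h5 (sq_nonneg _)
    have h7 := abs_le_of_sq_le_sq h6 (mul_nonneg h4 K.2)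
    rw [abs_of_nonneg dist_nonneg] at h7
    have h8 := mul_le_mul_of_nonneg_right h3 K.coe_nonneg
    exact h7.trans (h8.trans_eq (by ring))
  have hc : 0 ≤ Real.cosh ((b - a) / 2) / 2 := by have := Real.cosh_pos ((b - a) / 2); positivity
  refine LipschitzOnWith.of_dist_le_mul fun s hs t ht => ?_
  rw [NNReal.coe_mul, Real.coe_toNNReal _ hc]
  rcases le_total s t with hst | hst
  · exact key s hs t ht hst
  · rw [dist_comm, dist_comm s]
    exact key t ht s hs hst

theorem continuous_geodesic (hb : ∀ t, γ t ∈ Metric.ball (0 : E) 1)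
    (hγ : ∀ s t, s ≤ t → poincareDist (γ s) (γ t) = t - s) : Continuous γ := by
  refine continuous_iff_continuousAt.2 fun t => ?_
  refine ((lipschitzOnWith_geodesic hb hγ (a := t - 1) (b := t + 1) (K := 1) ?_).continuousOn
    ).continuousAt (Icc_mem_nhds (by linarith) (by linarith))
  intro u _
  simp

end Geodesic

section

variable {n : ℕ}

theorem hyperbolicLength_geodesic_le {γ : ℝ → EuclideanSpace ℝ (Fin n)}
    (hb : ∀ t, γ t ∈ Metric.ball (0 : EuclideanSpace ℝ (Fin n)) 1)
    (hγ : ∀ s t, s ≤ t → poincareDist (γ s) (γ t) = t - s) {l : ℝ} (hl : 0 ≤ l) :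
    IsRectifiableCurve (Metric.ball 0 1) (γ 0) (γ l) γ 0 l ∧ hyperbolicLength γ 0 l ≤ l := by
  have hcont := continuous_geodesic hb hγ
  have hvar : ∀ s t : ℝ, ∀ K : NNReal, (∀ u ∈ Icc s t, 1 - ‖γ u‖ ^ 2 ≤ K) →
      eVariationOn γ (Icc s t) ≤
        ENNReal.ofReal (Real.cosh ((t - s) / 2) / 2 * K * (t - s)) := by
    intro s t K hK
    have hc : 0 ≤ Real.cosh ((t - s) / 2) / 2 := by
      have := Real.cosh_pos ((t - s) / 2); positivity
    have := (lipschitzOnWith_geodesic hb hγ hK).comp_eVariationOn_le (g := id) (mapsTo_id _)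
    rw [eVariationOn_id_Icc, Function.comp_id] at this
    refine this.trans_eq ?_
    rw [ENNReal.ofReal_mul (p := Real.cosh ((t - s) / 2) / 2 * K) (mul_nonneg hc K.2),
      ENNReal.ofReal_mul hc]
    simp [ENNReal.ofReal]
  have h : IsRectifiableCurve (Metric.ball 0 1) (γ 0) (γ l) γ 0 l :=
    ⟨hl, hcont.continuousOn, ne_top_of_le_ne_top ENNReal.ofReal_ne_top
      (hvar 0 l 1 fun u _ => by simp), fun t _ => hb t, rfl, rfl⟩
  refine ⟨h, ?_⟩
  obtain ⟨g, hg, hgc, hlen⟩ := h.exists_density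
  have himg := h.image_variationOnFromTo
  have hVl := h.variationOnFromTo_right
  have h0 := left_mem_Icc.2 h.le
  have hVc := continuousOn_variationOnFromTo h.locallyBoundedVariationOn h.continuousOn h0
  have hVm := variationOnFromTo.monotoneOn h.locallyBoundedVariationOn h0
  have hV0 := variationOnFromTo.self γ (Icc 0 l) 0
  have hgV : ∀ t ∈ Icc 0 l, g (variationOnFromTo γ (Icc 0 l) 0 t) = 2 / (1 - ‖γ t‖ ^ 2) := by
    intro t ht
    rw [hgc _ (himg ▸ mem_image_of_mem _ ht), h.naturalParameterization_variationOnFromTo ht]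
  have hVdiff : ∀ s ∈ Icc 0 l, ∀ t ∈ Icc 0 l, s ≤ t →
      variationOnFromTo γ (Icc 0 l) 0 t - variationOnFromTo γ (Icc 0 l) 0 s =
        (eVariationOn γ (Icc s t)).toReal := by
    intro s hs t ht hst
    rw [variationOnFromTo.sub_right h.locallyBoundedVariationOn h0 ht hs,
      variationOnFromTo.eq_of_le _ _ hst, inter_eq_right.2 (Icc_subset_Icc hs.1 ht.2)]
  set V := variationOnFromTo γ (Icc 0 l) 0
  rw [hlen, ← hVl]
  have hBc : Continuous fun u => ∫ t in (0 : ℝ)..u, g t :=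
    continuous_iff_continuousAt.2 fun s => (hg.integral_hasStrictDerivAt 0 s).hasDerivAt.continuousAt
  -- The hyperbolic length of γ on [0, s] is compared with s: its right slopes are asymptotically at
  -- most 1.
  refine image_le_of_liminf_slope_right_le_deriv_boundary
    (f := fun s => ∫ t in (0 : ℝ)..V s, g t) (B := id) (B' := fun _ => 1) (a := 0) (b := l)
    (hBc.comp_continuousOn hVc) (by simp [hV0]) continuousOn_id
    (fun s _ => hasDerivWithinAt_id _ _) ?_ (right_mem_Icc.2 hl)
  intro s hs r hr
  have hsl : s ∈ Icc 0 l := ⟨hs.1, hs.2.le⟩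
  have hA := one_sub_norm_sq_pos (hb s)
  set A := 1 - ‖γ s‖ ^ 2
  -- Three errors of a factor p each: the cosh in the Lipschitz constant, and the upper and lower
  -- bounds for 1 - |γ|² near s.
  obtain ⟨p, hp, hp1⟩ : ∃ p : ℝ, p ^ 3 < r ∧ 1 < p := by
    have h1 : ∀ᶠ p in 𝓝[>] (1 : ℝ), p ^ 3 < r :=
      ((continuous_pow 3).continuousWithinAt.eventually_lt continuousWithinAt_const (by simpa))
    exact (h1.and self_mem_nhdsWithin).exists
  have hp0 : 0 < p := by linarith
  have hAp : A < p * A := by nlinarith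
  have hAp' : A / p < A := by rw [div_lt_iff₀ hp0]; nlinarith
  have hnear : ∀ᶠ u in 𝓝 s, A / p < 1 - ‖γ u‖ ^ 2 ∧ 1 - ‖γ u‖ ^ 2 < p * A := by
    have hcA : Continuous fun u => 1 - ‖γ u‖ ^ 2 := by fun_prop
    exact (hcA.continuousAt.eventually (lt_mem_nhds hAp')).and
      (hcA.continuousAt.eventually (gt_mem_nhds hAp))
  obtain ⟨ε, hε, hball⟩ := Metric.eventually_nhds_iff.1 hnear
  have hcosh : ∀ᶠ z in 𝓝[>] s, Real.cosh ((z - s) / 2) < p := by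
    have : Continuous fun z => Real.cosh ((z - s) / 2) := by fun_prop
    exact this.continuousWithinAt.eventually_lt continuousWithinAt_const (by simpa)
  refine Eventually.frequently ?_
  filter_upwards [hcosh, Ioo_mem_nhdsGT hs.2,
    Ioo_mem_nhdsGT (show s < s + ε by linarith)] with z hz hzl hzε
  have hsz : 0 < z - s := sub_pos.2 hzl.1
  have hzl' : z ∈ Icc 0 l := ⟨hs.1.trans hzl.1.le, hzl.2.le⟩
  have hsub : Icc s z ⊆ Icc 0 l := Icc_subset_Icc hs.1 hzl.2.le
  have hu : ∀ u ∈ Icc s z, A / p < 1 - ‖γ u‖ ^ 2 ∧ 1 - ‖γ u‖ ^ 2 < p * A := by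
    intro u hu
    refine hball ?_
    rw [Real.dist_eq, abs_of_nonneg (by linarith [hu.1])]
    linarith [hu.2, hzε.2]
  have hVsz : V s ≤ V z := hVm hsl hzl' hzl.1.le
  have hint : (∫ t in (0 : ℝ)..V z, g t) - ∫ t in (0 : ℝ)..V s, g t ≤
      2 / (A / p) * (V z - V s) := by
    rw [intervalIntegral.integral_interval_sub_left (hg.intervalIntegrable _ _)
      (hg.intervalIntegrable _ _)]
    have := intervalIntegral.norm_integral_le_of_norm_le_const (a := V s) (b := V z) (f := g)
      (C := 2 / (A / p)) ?_
    · rw [abs_of_nonneg (sub_nonneg.2 hVsz)] at this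
      exact (le_abs_self _).trans this
    intro v hv
    rw [uIoc_of_le hVsz] at hv
    obtain ⟨u, hu', rfl⟩ := intermediate_value_Icc hzl.1.le (hVc.mono hsub) (Ioc_subset_Icc_self hv)
    rw [hgV u (hsub hu'), Real.norm_eq_abs,
      abs_of_pos (div_pos two_pos (one_sub_norm_sq_pos (hb u)))]
    exact div_le_div_of_nonneg_left zero_le_two (by positivity) (hu u hu').1.le
  have hV : V z - V s ≤ p / 2 * (p * A) * (z - s) := by
    rw [hVdiff s hsl z hzl' hzl.1.le]
    have h1 := hvar s z (Real.toNNReal (p * A)) fun u hu' => by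
      rw [Real.coe_toNNReal _ (by positivity)]
      exact (hu u hu').2.le
    rw [Real.coe_toNNReal _ (by positivity)] at h1
    have hc := Real.cosh_pos ((z - s) / 2)
    refine (ENNReal.toReal_le_of_le_ofReal (by positivity) h1).trans ?_
    gcongr
  rw [slope_def_field, div_lt_iff₀ hsz]
  calc (∫ t in (0 : ℝ)..V z, g t) - ∫ t in (0 : ℝ)..V s, g t
      ≤ 2 / (A / p) * (p / 2 * (p * A) * (z - s)) :=
        hint.trans (mul_le_mul_of_nonneg_left hV (by positivity))
    _ = p ^ 3 * (z - s) := by field_simp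
    _ < r * (z - s) := mul_lt_mul_of_pos_right hp hsz

theorem hyperbolicMetric_eq_poincareDist [Nontrivial (EuclideanSpace ℝ (Fin n))]
    {x y : EuclideanSpace ℝ (Fin n)} (hx : x ∈ Metric.ball (0 : EuclideanSpace ℝ (Fin n)) 1)
    (hy : y ∈ Metric.ball (0 : EuclideanSpace ℝ (Fin n)) 1) :
    hyperbolicMetric x y = poincareDist x y := by
  obtain ⟨γ, h0, h1, hb, hγ⟩ := exists_geodesic hx hy
  have h := hyperbolicLength_geodesic_le hb hγ (poincareDist_nonneg x y)
  rw [h0, h1] at h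
  have hlow : ∀ m ∈ {m : ℝ | ∃ (γ : ℝ → EuclideanSpace ℝ (Fin n)) (a b : ℝ),
      IsRectifiableCurve (Metric.ball 0 1) x y γ a b ∧ m = hyperbolicLength γ a b},
      poincareDist x y ≤ m := by
    rintro _ ⟨γ, a, b, hγ, rfl⟩
    exact poincareDist_le_hyperbolicLength hγ
  exact le_antisymm ((csInf_le ⟨_, hlow⟩ ⟨γ, 0, _, h.1, rfl⟩).trans h.2)
    (le_csInf ⟨_, γ, 0, _, h.1, rfl⟩ hlow)

end

/-! ### Real inequalities behind the inclusions -/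

section Inequalities

variable {t u D κ S : ℝ}

theorem sinh_half_eq (r : ℝ) :
    Real.exp (r / 2) ^ 2 - 1 = 2 * Real.exp (r / 2) * Real.sinh (r / 2) := by
  rw [Real.sinh_eq, Real.exp_neg]
  have := Real.exp_pos (r / 2)
  field_simp

theorem exp_sub_one_half_eq (r : ℝ) :
    (Real.exp r - 1) / 2 = Real.exp (r / 2) * Real.sinh (r / 2) := by
  have h : Real.exp r = Real.exp (r / 2) ^ 2 := by rw [← Real.exp_nat_mul]; congr 1; push_cast; ring
  have := sinh_half_eq r
  rw [h, this]
  ring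

/-- The distance of two points on a diameter in terms of the products of the distances to its end
points. -/
theorem four_mul_sq_mul_sub (hS : κ ^ 2 - 1 = 2 * κ * S) (P Q : ℝ) :
    4 * κ ^ 2 * (S ^ 2 * (P * Q) - ((P - Q) / 2) ^ 2) = (κ ^ 2 * Q - P) * (κ ^ 2 * P - Q) := by
  have : 4 * κ ^ 2 * S ^ 2 = (κ ^ 2 - 1) ^ 2 := by rw [hS]; ring
  linear_combination P * Q * this

theorem sq_lt_of_lt_mul_sinh (ht : 0 ≤ t) (ht1 : t < 1) (hu : 0 ≤ u) (hu1 : u < 1) (hD : 0 ≤ D)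
    (hS0 : 0 < S) (h1 : D < (1 + t) * S * (1 - t)) (h2 : D < (1 + t) * S * (1 - u)) :
    D ^ 2 < S ^ 2 * ((1 - t ^ 2) * (1 - u ^ 2)) := by
  rcases le_total u t with h | h
  · refine (pow_lt_pow_left₀ h1 hD two_ne_zero).trans_le ?_
    have : ((1 + t) * S * (1 - t)) ^ 2 = S ^ 2 * ((1 - t ^ 2) * (1 - t ^ 2)) := by ring
    rw [this]
    gcongr
    nlinarith
  · refine (pow_lt_pow_left₀ h2 hD two_ne_zero).trans_le ?_
    have : S ^ 2 * ((1 - t ^ 2) * (1 - u ^ 2)) - ((1 + t) * S * (1 - u)) ^ 2 =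
        S ^ 2 * (1 + t) * (1 - u) * (2 * (u - t)) := by ring
    have : 0 ≤ S ^ 2 * (1 + t) * (1 - u) * (2 * (u - t)) := by
      have h3 := sub_nonneg.2 h
      have h4 := sub_pos.2 hu1
      positivity
    linarith

/-- If κ²(1 - t)(1 - u) ≤ (1 + t)(1 + u), squaring `h2` suffices. Otherwise even the farthest point
of norm u, at distance t + u, lies in the hyperbolic ball. -/
theorem sq_lt_of_lt_mul_exp (ht : 0 ≤ t) (ht1 : t < 1) (hu : 0 ≤ u) (hu1 : u < 1) (hD : 0 ≤ D)
    (hκ : 1 < κ) (hS : κ ^ 2 - 1 = 2 * κ * S) (hDtu : D ≤ t + u)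
    (h2 : D < (1 - t) * (κ * S) * (1 - u)) :
    D ^ 2 < S ^ 2 * ((1 - t ^ 2) * (1 - u ^ 2)) := by
  have ht' := sub_pos.2 ht1
  have hu' := sub_pos.2 hu1
  rcases le_or_gt (κ ^ 2 * ((1 - t) * (1 - u))) ((1 + t) * (1 + u)) with h | h
  · refine (pow_lt_pow_left₀ h2 hD two_ne_zero).trans_le ?_
    have e : S ^ 2 * ((1 - t ^ 2) * (1 - u ^ 2)) - ((1 - t) * (κ * S) * (1 - u)) ^ 2 =
        S ^ 2 * (1 - t) * (1 - u) * ((1 + t) * (1 + u) - κ ^ 2 * ((1 - t) * (1 - u))) := by ring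
    have h3 := sub_nonneg.2 h
    have : 0 ≤ S ^ 2 * (1 - t) * (1 - u) *
        ((1 + t) * (1 + u) - κ ^ 2 * ((1 - t) * (1 - u))) := by positivity
    linarith
  · refine (pow_le_pow_left₀ hD hDtu 2).trans_lt ?_
    have e := four_mul_sq_mul_sub hS ((1 + t) * (1 + u)) ((1 - t) * (1 - u))
    have h3 : (1 - t) * (1 - u) ≤ (1 + t) * (1 + u) := by nlinarith
    have h4 : 0 < κ ^ 2 * ((1 + t) * (1 + u)) - (1 - t) * (1 - u) := by
      have : 0 < (1 + t) * (1 + u) := by positivity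
      nlinarith
    have h5 := mul_pos (sub_pos.2 h) h4
    rw [← e] at h5
    have h6 := (pos_iff_pos_of_mul_pos h5).1 (by positivity)
    linarith

theorem lt_mul_exp_of_sq_lt (ht : 0 ≤ t) (ht1 : t < 1) (hu : 0 ≤ u) (hu1 : u < 1)
    (hκ : 1 < κ) (hS : κ ^ 2 - 1 = 2 * κ * S) (hS0 : 0 < S) (hDtu : |t - u| ≤ D)
    (h : D ^ 2 < S ^ 2 * ((1 - t ^ 2) * (1 - u ^ 2))) :
    D < (1 + t) * (κ * S) * (1 - t) ∧ D < (1 + t) * (κ * S) * (1 - u) := by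
  have ht' := sub_pos.2 ht1
  have hu' := sub_pos.2 hu1
  have hκ0 : 0 < κ := by linarith
  have hκ2 : 1 < κ ^ 2 := by nlinarith
  set P := (1 + t) * (1 - u) with hP
  set Q := (1 - t) * (1 + u) with hQ
  have hP0 : 0 < P := by positivity
  have hQ0 : 0 < Q := by positivity
  have e := four_mul_sq_mul_sub hS P Q
  have h1 := sq_le_sq' (by linarith [abs_nonneg (t - u)]) hDtu
  rw [sq_abs] at h1
  have h2 : 0 < S ^ 2 * (P * Q) - ((P - Q) / 2) ^ 2 := by
    have e1 : P * Q = (1 - t ^ 2) * (1 - u ^ 2) := by rw [hP, hQ]; ring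
    have e2 : (P - Q) / 2 = t - u := by rw [hP, hQ]; ring
    rw [e1, e2]
    linarith
  have h3 : 0 < (κ ^ 2 * Q - P) * (κ ^ 2 * P - Q) := by rw [← e]; positivity
  -- The factors have the same sign, and their sum (κ² - 1)(P + Q) is positive.
  have h4 : 0 < κ ^ 2 * Q - P ∧ 0 < κ ^ 2 * P - Q := by
    rcases mul_pos_iff.1 h3 with h | h
    · exact h
    · nlinarith
  have key : ∀ B : ℝ, 0 < B → (1 - t ^ 2) * (1 - u ^ 2) ≤ ((1 + t) * κ * B) ^ 2 →
      D < (1 + t) * (κ * S) * B := by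
    intro B hB hle
    refine lt_of_pow_lt_pow_left₀ 2 (by positivity) (h.trans_le ?_)
    calc S ^ 2 * ((1 - t ^ 2) * (1 - u ^ 2)) ≤ S ^ 2 * ((1 + t) * κ * B) ^ 2 := by gcongr
      _ = _ := by ring
  refine ⟨key _ ht' ?_, key _ hu' ?_⟩
  · have e1 : ((1 + t) * κ * (1 - t)) ^ 2 = (1 - t ^ 2) * (κ ^ 2 * (1 - t ^ 2)) := by ring
    have h5 : 0 ≤ 1 - t ^ 2 := by nlinarith
    rw [e1]
    refine mul_le_mul_of_nonneg_left ?_ h5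
    rcases le_total u t with hut | hut
    · have h6 := mul_pos h4.1 (show 0 < 1 + u by linarith)
      have h7 : κ ^ 2 * ((1 - t) * (1 + u) * (1 + u)) ≤ κ ^ 2 * ((1 - t) * (1 + t) * (1 + t)) := by
        gcongr
      have h8 : (1 + t) * (1 - u ^ 2) ≤ (1 + t) * (κ ^ 2 * (1 - t ^ 2)) := by
        rw [hP, hQ] at h6
        linarith
      exact le_of_mul_le_mul_left h8 (by positivity)
    · nlinarith
  · have h5 := mul_pos h4.2 hP0
    rw [hP, hQ] at h5
    linarith

/-- The point of a diameter with prescribed ratio of the distances to its end points. -/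
theorem exists_ratio_eq {a b : ℝ} (hb : 0 < b) (hab : b ≤ a) :
    ∃ u, 0 ≤ u ∧ u < 1 ∧ (1 + u) * b = (1 - u) * a := by
  refine ⟨(a - b) / (a + b), div_nonneg (by linarith) (by linarith),
    (div_lt_one (by linarith)).2 (by linarith), ?_⟩
  have : a + b ≠ 0 := by linarith
  field_simp
  ring

end Inequalities

/-! ### The distance ratio metric of the ball -/

section JMetric

variable {n : ℕ}

theorem infDist_frontier_ball [Nontrivial (EuclideanSpace ℝ (Fin n))]
    {z : EuclideanSpace ℝ (Fin n)} (hz : z ∈ Metric.ball (0 : EuclideanSpace ℝ (Fin n)) 1) :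
    Metric.infDist z (frontier (Metric.ball 0 1)) = 1 - ‖z‖ := by
  rw [frontier_ball _ one_ne_zero]
  obtain ⟨e, he, hze⟩ := exists_unit_eq_norm_smul z
  have hes : e ∈ Metric.sphere (0 : EuclideanSpace ℝ (Fin n)) 1 := by simpa using he
  rw [mem_ball_zero_iff] at hz
  apply le_antisymm
  · refine (Metric.infDist_le_dist_of_mem hes).trans_eq ?_
    have : e - z = (1 - ‖z‖) • e := by
      nth_rewrite 1 [hze]
      rw [sub_smul, one_smul]
    rw [dist_comm, dist_eq_norm, this, norm_smul, he, mul_one, Real.norm_eq_abs,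
      abs_of_pos (by linarith)]
  · refine (Metric.le_infDist ⟨e, hes⟩).2 fun w hw => ?_
    rw [mem_sphere_zero_iff_norm] at hw
    rw [← hw, dist_comm, dist_eq_norm]
    exact norm_sub_norm_le w z

theorem jMetric_ball_eq [Nontrivial (EuclideanSpace ℝ (Fin n))]
    {x y : EuclideanSpace ℝ (Fin n)} (hx : x ∈ Metric.ball (0 : EuclideanSpace ℝ (Fin n)) 1)
    (hy : y ∈ Metric.ball (0 : EuclideanSpace ℝ (Fin n)) 1) :
    jMetric (Metric.ball 0 1) x y = Real.log (1 + dist x y / min (1 - ‖x‖) (1 - ‖y‖)) := by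
  rw [jMetric, infDist_frontier_ball hx, infDist_frontier_ball hy]

theorem jMetric_ball_lt_log_iff [Nontrivial (EuclideanSpace ℝ (Fin n))]
    {x y : EuclideanSpace ℝ (Fin n)} {R : ℝ}
    (hx : x ∈ Metric.ball (0 : EuclideanSpace ℝ (Fin n)) 1)
    (hy : y ∈ Metric.ball (0 : EuclideanSpace ℝ (Fin n)) 1) (hR : 0 ≤ R) :
    jMetric (Metric.ball 0 1) x y < Real.log (1 + R) ↔
      dist x y < R * (1 - ‖x‖) ∧ dist x y < R * (1 - ‖y‖) := by
  have h1 := sub_pos.2 (mem_ball_zero_iff.1 hx)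
  have h2 := sub_pos.2 (mem_ball_zero_iff.1 hy)
  have hm : 0 < min (1 - ‖x‖) (1 - ‖y‖) := lt_min h1 h2
  rw [jMetric_ball_eq hx hy, Real.log_lt_log_iff (by positivity) (by positivity),
    add_lt_add_iff_left, div_lt_iff₀ hm, mul_min_of_nonneg _ _ hR, lt_min_iff]

theorem jMetric_ball_eq_log [Nontrivial (EuclideanSpace ℝ (Fin n))]
    {x y : EuclideanSpace ℝ (Fin n)} {R : ℝ}
    (hx : x ∈ Metric.ball (0 : EuclideanSpace ℝ (Fin n)) 1)
    (hy : y ∈ Metric.ball (0 : EuclideanSpace ℝ (Fin n)) 1) (hxy : ‖x‖ ≤ ‖y‖)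
    (hR : dist x y = R * (1 - ‖y‖)) :
    jMetric (Metric.ball 0 1) x y = Real.log (1 + R) := by
  have h2 := sub_pos.2 (mem_ball_zero_iff.1 hy)
  rw [jMetric_ball_eq hx hy, min_eq_right (by linarith), hR, mul_div_cancel_right₀ _ h2.ne']

end JMetric

/-! ### The two radii and their ratio -/

section Radii

theorem outerRadius_eq (t r : ℝ) : outerRadius t r =
    Real.log (1 + (1 + t) * (Real.exp (r / 2) * Real.sinh (r / 2))) := by
  rw [outerRadius, exp_sub_one_half_eq]

theorem innerRadius_eq (t r : ℝ) : innerRadius t r =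
    max (Real.log (1 + (1 + t) * Real.sinh (r / 2)))
      (Real.log (1 + (1 - t) * (Real.exp (r / 2) * Real.sinh (r / 2)))) := by
  rw [innerRadius, exp_sub_one_half_eq]

theorem continuousAt_outerRadius {t r : ℝ} (ht : 0 ≤ t) (hr : 0 < r) :
    ContinuousAt (outerRadius t) r := by
  have h : 0 < Real.exp r - 1 := by linarith [Real.one_lt_exp_iff.2 hr]
  have h0 : 1 + (1 + t) * ((Real.exp r - 1) / 2) ≠ 0 := by positivity
  unfold outerRadius
  exact ContinuousAt.log (by fun_prop) h0

theorem innerRadius_le_outerRadius {t r : ℝ} (ht : 0 ≤ t) (ht1 : t < 1) (hr : 0 < r) :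
    innerRadius t r ≤ outerRadius t r := by
  have hκ : 1 < Real.exp (r / 2) := Real.one_lt_exp_iff.2 (by linarith)
  have hS : 0 < Real.sinh (r / 2) := Real.sinh_pos_iff.2 (by linarith)
  have ht' := sub_pos.2 ht1
  rw [innerRadius_eq, outerRadius_eq]
  refine max_le (Real.log_le_log (by positivity) ?_) (Real.log_le_log (by positivity) ?_)
  · gcongr
    nlinarith
  · gcongr
    linarith

theorem tendsto_outerRadius_div_innerRadius {t : ℝ} (ht : 0 ≤ t) (ht1 : t < 1) :
    Tendsto (fun r => outerRadius t r / innerRadius t r) (𝓝[>] 0) (𝓝 1) := by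
  have h1 : HasDerivAt (outerRadius t) ((1 + t) / 2) 0 := by
    have := ((((Real.hasDerivAt_exp 0).sub_const 1).div_const 2).const_mul (1 + t)).const_add 1
    refine HasDerivAt.congr_deriv (this.log (by simp)) ?_
    simp [div_eq_mul_inv]
  have h2 : HasDerivAt (fun r => Real.log (1 + (1 + t) * Real.sinh (r / 2))) ((1 + t) / 2) 0 := by
    have := ((((hasDerivAt_id (0 : ℝ)).div_const 2).sinh).const_mul (1 + t)).const_add 1
    refine HasDerivAt.congr_deriv (this.log (by simp)) ?_
    simp [div_eq_mul_inv]
  -- M/m lies between 1 and the quotient of M by the first term of m, whose limit is the quotient of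
  -- two equal derivatives.
  have h3 := h1.tendsto_slope_zero_right.div h2.tendsto_slope_zero_right (by positivity)
  rw [div_self (by positivity)] at h3
  refine tendsto_of_tendsto_of_tendsto_of_le_of_le' tendsto_const_nhds h3 ?_ ?_
  all_goals
    filter_upwards [self_mem_nhdsWithin] with r hr
    have hr : 0 < r := hr
    have hS : 0 < Real.sinh (r / 2) := Real.sinh_pos_iff.2 (by linarith)
    have hf : 0 < Real.log (1 + (1 + t) * Real.sinh (r / 2)) := Real.log_pos (by
      have : 0 < (1 + t) * Real.sinh (r / 2) := by positivity
      linarith)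
    have hfm : Real.log (1 + (1 + t) * Real.sinh (r / 2)) ≤ innerRadius t r := le_max_left _ _
    have hmM := innerRadius_le_outerRadius ht ht1 hr
  · exact (one_le_div (hf.trans_le hfm)).2 hmM
  · have e : outerRadius t 0 = 0 := by simp [outerRadius]
    simp only [Pi.div_apply, zero_add, e, zero_div, Real.sinh_zero, mul_zero, add_zero, Real.log_one, sub_zero,
      smul_eq_mul]
    rw [mul_div_mul_left _ _ (inv_pos.2 hr).ne']
    exact div_le_div_of_nonneg_left (by linarith) hf hfm

end Radii

/-! ### Extremal points -/

section Sharpness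

variable {E : Type*} [NormedAddCommGroup E] [InnerProductSpace ℝ E] {x : E} {r : ℝ}

theorem exists_outward_point [Nontrivial E] (hx : x ∈ Metric.ball (0 : E) 1) (hr : 0 < r) :
    ∃ y ∈ Metric.ball (0 : E) 1, poincareDist x y = r ∧ ‖x‖ ≤ ‖y‖ ∧
      dist x y = (1 + ‖x‖) * (Real.exp (r / 2) * Real.sinh (r / 2)) * (1 - ‖y‖) := by
  obtain ⟨e, he, hxe⟩ := exists_unit_eq_norm_smul x
  have hκ : 1 < Real.exp (r / 2) := Real.one_lt_exp_iff.2 (by linarith)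
  have hS := sinh_half_eq r
  have ht := norm_nonneg x
  have ht' := sub_pos.2 (mem_ball_zero_iff.1 hx)
  set t := ‖x‖
  set κ := Real.exp (r / 2)
  set S := Real.sinh (r / 2)
  have hκ2 : 1 < κ ^ 2 := by nlinarith
  -- Chosen to annihilate the factor κ²P - Q of `four_mul_sq_mul_sub`, that is, to lie at distance r
  -- beyond x.
  obtain ⟨u, hu0, hu1, hu⟩ := exists_ratio_eq (a := κ ^ 2 * (1 + t)) ht' (by nlinarith)
  have hut : t ≤ u := by
    have : (1 - u) * (1 + t) ≤ (1 + u) * (1 - t) := by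
      rw [hu]
      exact mul_le_mul_of_nonneg_left (by nlinarith) (by linarith)
    linarith
  have hnu : ‖u • e‖ = u := by rw [norm_smul, he, mul_one, Real.norm_eq_abs, abs_of_nonneg hu0]
  have hy : u • e ∈ Metric.ball (0 : E) 1 := by rwa [mem_ball_zero_iff, hnu]
  have hd : dist x (u • e) = u - t := by
    rw [hxe, dist_comm, dist_eq_norm, ← sub_smul, norm_smul, he, mul_one, Real.norm_eq_abs,
      abs_of_nonneg (by linarith)]
  refine ⟨u • e, hy, poincareDist_eq_of_sq hx hy hr.le ?_, by rwa [hnu], ?_⟩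
  · rw [hd, hnu]
    have e1 := four_mul_sq_mul_sub hS ((1 + t) * (1 - u)) ((1 - t) * (1 + u))
    have e2 : κ ^ 2 * ((1 + t) * (1 - u)) - (1 - t) * (1 + u) = 0 := by linarith
    rw [e2, mul_zero] at e1
    have e3 := (mul_eq_zero.1 e1).resolve_left (by positivity)
    linarith
  · rw [hd, hnu]
    linear_combination (1 / 2) * hu + (1 + t) * (1 - u) / 2 * hS

theorem exists_inward_point [Nontrivial E] (hx : x ∈ Metric.ball (0 : E) 1) (hr : 0 < r)
    (h : 1 + ‖x‖ ≤ (1 - ‖x‖) * Real.exp (r / 2)) :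
    ∃ y ∈ Metric.ball (0 : E) 1, poincareDist x y = r ∧ ‖x‖ ≤ ‖y‖ ∧
      dist x y = (1 - ‖x‖) * (Real.exp (r / 2) * Real.sinh (r / 2)) * (1 - ‖y‖) := by
  obtain ⟨e, he, hxe⟩ := exists_unit_eq_norm_smul x
  have hκ : 1 < Real.exp (r / 2) := Real.one_lt_exp_iff.2 (by linarith)
  have hS := sinh_half_eq r
  have ht := norm_nonneg x
  have ht' := sub_pos.2 (mem_ball_zero_iff.1 hx)
  set t := ‖x‖
  set κ := Real.exp (r / 2)
  set S := Real.sinh (r / 2)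
  have h2 : (1 + t) * (1 + t) ≤ (1 - t) * (κ ^ 2 * (1 - t)) := by
    calc (1 + t) * (1 + t) ≤ (1 - t) * κ * ((1 - t) * κ) := mul_le_mul h h (by positivity)
          (by positivity)
      _ = _ := by ring
  have h3 : 1 + t ≤ κ ^ 2 * (1 - t) := by nlinarith
  -- The point across the origin at distance r; `h2`, the square of `h`, is what gives u ≥ t.
  obtain ⟨u, hu0, hu1, hu⟩ := exists_ratio_eq (a := κ ^ 2 * (1 - t)) (show 0 < 1 + t by positivity)
    h3
  have hut : t ≤ u := by nlinarith
  have hnu : ‖-u • e‖ = u := by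
    rw [norm_smul, he, mul_one, norm_neg, Real.norm_eq_abs, abs_of_nonneg hu0]
  have hy : -u • e ∈ Metric.ball (0 : E) 1 := by rwa [mem_ball_zero_iff, hnu]
  have hd : dist x (-u • e) = t + u := by
    rw [hxe, dist_eq_norm, ← sub_smul, norm_smul, he, mul_one, Real.norm_eq_abs, sub_neg_eq_add,
      abs_of_nonneg (by linarith)]
  refine ⟨-u • e, hy, poincareDist_eq_of_sq hx hy hr.le ?_, by rwa [hnu], ?_⟩
  · rw [hd, hnu]
    have e1 := four_mul_sq_mul_sub hS ((1 + t) * (1 + u)) ((1 - t) * (1 - u))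
    have e2 : κ ^ 2 * ((1 - t) * (1 - u)) - (1 + t) * (1 + u) = 0 := by linarith
    rw [e2, zero_mul] at e1
    have e3 := (mul_eq_zero.1 e1).resolve_left (by positivity)
    linarith
  · rw [hd, hnu]
    linear_combination (1 / 2) * hu + (1 - t) * (1 - u) / 2 * hS

/-- The sphere |y| = |x| is connected in dimension at least 2, so |x - y| takes every value in [0,
2|x|] on it; `h` puts the required chord in this range. -/
theorem exists_equidistant_point (hE : 1 < Module.rank ℝ E) (hx : x ∈ Metric.ball (0 : E) 1)
    (hr : 0 < r) (h : (1 - ‖x‖) * Real.exp (r / 2) ≤ 1 + ‖x‖) :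
    ∃ y ∈ Metric.ball (0 : E) 1, poincareDist x y = r ∧ ‖x‖ ≤ ‖y‖ ∧
      dist x y = (1 + ‖x‖) * Real.sinh (r / 2) * (1 - ‖y‖) := by
  have hκ : 1 < Real.exp (r / 2) := Real.one_lt_exp_iff.2 (by linarith)
  have hS0 : 0 < Real.sinh (r / 2) := Real.sinh_pos_iff.2 (by linarith)
  have hS := sinh_half_eq r
  have ht := norm_nonneg x
  have ht' := sub_pos.2 (mem_ball_zero_iff.1 hx)
  have hD : (1 + ‖x‖) * Real.sinh (r / 2) * (1 - ‖x‖) ≤ 2 * ‖x‖ := by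
    set t := ‖x‖
    set κ := Real.exp (r / 2)
    have h1 : ((1 - t) * κ - (1 + t)) * ((1 + t) * κ + (1 - t)) ≤ 0 :=
      mul_nonpos_of_nonpos_of_nonneg (by linarith) (by positivity)
    have h2 : 2 * κ * ((1 + t) * Real.sinh (r / 2) * (1 - t)) ≤ 2 * κ * (2 * t) := by
      have : 2 * κ * ((1 + t) * Real.sinh (r / 2) * (1 - t)) = (1 - t ^ 2) * (κ ^ 2 - 1) := by
        rw [hS]; ring
      rw [this]
      linarith
    exact le_of_mul_le_mul_left h2 (by positivity)
  have hx1 : x ∈ Metric.sphere (0 : E) ‖x‖ := by simp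
  have hx2 : -x ∈ Metric.sphere (0 : E) ‖x‖ := by simp
  have hneg : dist x (-x) = 2 * ‖x‖ := by
    rw [dist_eq_norm, sub_neg_eq_add, ← two_smul ℝ, norm_smul, Real.norm_ofNat]
  obtain ⟨y, hy, hxy⟩ := (isPreconnected_sphere hE (0 : E) ‖x‖).intermediate_value hx1 hx2
    (f := fun y => dist x y) (by fun_prop)
    (show (1 + ‖x‖) * Real.sinh (r / 2) * (1 - ‖x‖) ∈ Icc (dist x x) (dist x (-x)) from
      ⟨by rw [dist_self]; positivity, by rwa [hneg]⟩)
  rw [mem_sphere_zero_iff_norm] at hy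
  have hxy : dist x y = (1 + ‖x‖) * Real.sinh (r / 2) * (1 - ‖x‖) := hxy
  have hyb : y ∈ Metric.ball (0 : E) 1 := by
    rw [mem_ball_zero_iff, hy]
    linarith
  refine ⟨y, hyb, poincareDist_eq_of_sq hx hyb hr.le ?_, hy.ge, by rw [hy, hxy]⟩
  rw [hxy, hy]
  ring

end Sharpness

end BallInclusion

end

open BallInclusion

theorem theorem3p1 (n : ℕ) (hn : 2 ≤ n) (x : EuclideanSpace ℝ (Fin n))
    (hx : x ∈ Metric.ball (0 : EuclideanSpace ℝ (Fin n)) 1) :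
    (∀ r : ℝ, 0 < r →
      -- the two inclusions
      (BallInclusion.jBall (Metric.ball 0 1) x (BallInclusion.innerRadius ‖x‖ r) ⊆
          BallInclusion.hyperbolicBall x r ∧
        BallInclusion.hyperbolicBall x r ⊆
          BallInclusion.jBall (Metric.ball 0 1) x (BallInclusion.outerRadius ‖x‖ r)) ∧
      -- sharpness: no larger inner radius and no smaller outer radius is possible
      (∀ s : ℝ, BallInclusion.innerRadius ‖x‖ r < s →
        ¬ BallInclusion.jBall (Metric.ball 0 1) x s ⊆ BallInclusion.hyperbolicBall x r) ∧
      (∀ s : ℝ, s < BallInclusion.outerRadius ‖x‖ r →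
        ¬ BallInclusion.hyperbolicBall x r ⊆ BallInclusion.jBall (Metric.ball 0 1) x s)) ∧
    Tendsto (fun r : ℝ => BallInclusion.outerRadius ‖x‖ r / BallInclusion.innerRadius ‖x‖ r)
      (𝓝[>] 0) (𝓝 1) := by
  have hrank : 1 < Module.rank ℝ (EuclideanSpace ℝ (Fin n)) := by
    rw [← Module.finrank_eq_rank, finrank_euclideanSpace_fin]
    exact_mod_cast hn
  have : Nontrivial (EuclideanSpace ℝ (Fin n)) := rank_pos_iff_nontrivial.1 (one_pos.trans hrank)
  have ht := norm_nonneg x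
  have ht1 := mem_ball_zero_iff.1 hx
  have ht' := sub_pos.2 ht1
  refine ⟨fun r hr => ?_, tendsto_outerRadius_div_innerRadius ht ht1⟩
  have hκ : 1 < Real.exp (r / 2) := Real.one_lt_exp_iff.2 (by linarith)
  have hS0 : 0 < Real.sinh (r / 2) := Real.sinh_pos_iff.2 (by linarith)
  have hS := sinh_half_eq r
  refine ⟨⟨?_, ?_⟩, fun s hs hsub => ?_, fun s hs hsub => ?_⟩
  · rintro y ⟨hy, hj⟩
    refine ⟨hy, ?_⟩
    rw [hyperbolicMetric_eq_poincareDist hx hy, poincareDist_lt_iff hx hy hr.le]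
    rw [innerRadius_eq, lt_max_iff, jMetric_ball_lt_log_iff hx hy (by positivity),
      jMetric_ball_lt_log_iff hx hy (by positivity)] at hj
    have hy1 := mem_ball_zero_iff.1 hy
    rcases hj with ⟨h1, h2⟩ | ⟨-, h2⟩
    · exact sq_lt_of_lt_mul_sinh ht ht1 (norm_nonneg y) hy1 dist_nonneg hS0 h1 h2
    · refine sq_lt_of_lt_mul_exp ht ht1 (norm_nonneg y) hy1 dist_nonneg hκ hS ?_ h2
      rw [dist_eq_norm]
      exact norm_sub_le x y
  · rintro y ⟨hy, hρ⟩
    refine ⟨hy, ?_⟩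
    rw [hyperbolicMetric_eq_poincareDist hx hy, poincareDist_lt_iff hx hy hr.le] at hρ
    rw [outerRadius_eq, jMetric_ball_lt_log_iff hx hy (by positivity)]
    refine lt_mul_exp_of_sq_lt ht ht1 (norm_nonneg y) (mem_ball_zero_iff.1 hy) hκ hS hS0 ?_ hρ
    rw [dist_eq_norm]
    exact abs_norm_sub_norm_le x y
  · obtain ⟨y, hy, hρ, hj⟩ : ∃ y ∈ Metric.ball (0 : EuclideanSpace ℝ (Fin n)) 1,
        poincareDist x y = r ∧ jMetric (Metric.ball 0 1) x y ≤ innerRadius ‖x‖ r := by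
      rw [innerRadius_eq]
      rcases le_total ((1 - ‖x‖) * Real.exp (r / 2)) (1 + ‖x‖) with h | h
      · obtain ⟨y, hy, hρ, hxy, hd⟩ := exists_equidistant_point hrank hx hr h
        exact ⟨y, hy, hρ, (jMetric_ball_eq_log hx hy hxy hd).trans_le (le_max_left _ _)⟩
      · obtain ⟨y, hy, hρ, hxy, hd⟩ := exists_inward_point hx hr h
        exact ⟨y, hy, hρ, (jMetric_ball_eq_log hx hy hxy hd).trans_le (le_max_right _ _)⟩
    have := (hsub ⟨hy, hj.trans_lt hs⟩).2
    rw [hyperbolicMetric_eq_poincareDist hx hy, hρ] at this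
    exact this.false
  -- The extremal point for r is not in the open ball, so the one for a slightly smaller radius is
  -- used.
  · have h1 : ∀ᶠ r' in 𝓝[<] r, s < outerRadius ‖x‖ r' :=
      (continuousAt_outerRadius ht hr).continuousWithinAt.eventually (lt_mem_nhds hs)
    obtain ⟨r', hs', hr'⟩ := (h1.and (Ioo_mem_nhdsLT hr)).exists
    obtain ⟨y, hy, hρ, hxy, hd⟩ := exists_outward_point hx hr'.1
    have := (hsub ⟨hy, by rw [hyperbolicMetric_eq_poincareDist hx hy, hρ]; exact hr'.2⟩).2
    rw [jMetric_ball_eq_log hx hy hxy hd, ← outerRadius_eq] at this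
    exact this.not_gt hs'
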